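/- For integers $N\ge 0$ and $M$ let $\left[{N\atop M}\right]_q=\frac{(q)_N}{(q)_M(q)_{N-M}}$ if $0\le M\le N$ and $\left[{N\atop M}\right]_q=0$ otherwise, where $(q)_m=\prod_{l=1}^{m}(1-q^l)$. Let $n,k,i$ be non-negative integers with $1\le i\le k$. Then the sum on the left below has only finitely many nonzero terms, and the following identity of polynomials in $q$ (with integer coefficients) holds: $$\sum_{r=-\infty}^{\infty}(-1)^r q^{r((2k+1)r+2k-2i+1)/2}\left[{n\atop \left\lfloor\frac{n-k+i-(2k+1)r}{2}\right\rfloor}\right]_q =\sum_{\substack{n_1\ge\cdots\ge n_{k-1}\ge n_k=0\\ 2(n_1+\cdots+n_{k-1})\le n-k+i}} q^{n_1^2+\cdots+n_{k-1}^2+n_i+\cdots+n_{k-1}}\prod_{j=1}^{k-1}\left[{n-2(n_1+\cdots+n_{j-1})-n_j-n_{j+1}-\alpha^{(k)}_{ij}\atop n_j-n_{j+1}}\right]_q .$$ Here the right-hand sum is over integers $n_1,\dots,n_{k-1}$ (with $n_k=0$; the sum $n_i+\cdots+n_{k-1}$ is empty if $i=k$; for $k=1$ there is exactly one, empty, tuple),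 and $\alpha^{(k)}_{ij}=\max(0,\,j-i+1)$ for $1\le i\le k$, $1\le j\le k-1$ are the entries of the $k\times(k-1)$ matrix $$A^{(k)}=\begin{pmatrix}1&2&\cdots&k-1\\0&1&\cdots&k-2\\ \vdots&\ddots&\ddots&\vdots\\0&\cdots&0&1\\0&\cdots&0&0\end{pmatrix}.$$ -/

import Mathlib

open Polynomial

namespace FiniteGordon

/-- The `q`-Pochhammer symbol `(q)_N = (1 - q)(1 - q^2)⋯(1 - q^N)` in `ℤ[q]`;
the indeterminate `q` is `X`. -/
noncomputable def qPochhammer (N : ℕ) : ℤ[X] :=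
  ∏ m ∈ Finset.range N, (1 - X ^ (m + 1))

/-- The Gaussian polynomial for natural numbers `N`, `M`, by the `q`-Pascal rule. -/
noncomputable def qChoose : ℕ → ℕ → ℤ[X]
  | _, 0 => 1
  | 0, _ + 1 => 0
  | N + 1, M + 1 => qChoose N M + X ^ (M + 1) * qChoose N (M + 1)

/-- The Gaussian binomial `[N, M]_q` for integers `N ≥ 0` and `M`; it vanishes unless
`0 ≤ M ≤ N`. -/
noncomputable def gaussBinom (N M : ℤ) : ℤ[X] :=
  if 0 ≤ M ∧ M ≤ N then qChoose N.toNat M.toNat else 0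

theorem qPochhammer_ne_zero (N : ℕ) : qPochhammer N ≠ 0 := by
  refine Finset.prod_ne_zero_iff.2 fun m _ h => ?_
  have := congrArg (Polynomial.eval 0) h
  simp at this

theorem qChoose_eq_zero : ∀ (N M : ℕ), N < M → qChoose N M = 0
  | _, 0, h => absurd h (Nat.not_lt_zero _)
  | 0, _ + 1, _ => by simp [qChoose]
  | N + 1, M + 1, h => by
      rw [qChoose, qChoose_eq_zero N M (by omega), qChoose_eq_zero N (M + 1) (by omega)]
      simp

theorem qChoose_mul : ∀ a b : ℕ,
    qChoose (a + b) a * (qPochhammer a * qPochhammer b) = qPochhammer (a + b)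
  | 0, b => by simp [qChoose, qPochhammer]
  | a + 1, 0 => by
      have h := qChoose_mul a 0
      simp only [Nat.add_zero] at h ⊢
      rw [qChoose, qChoose_eq_zero a (a + 1) (by omega)]
      have e : qPochhammer (a + 1) = qPochhammer a * (1 - X ^ (a + 1)) :=
        Finset.prod_range_succ _ _
      rw [e]
      linear_combination (1 - X ^ (a + 1)) * h
  | a + 1, b + 1 => by
      have h₁ := qChoose_mul a (b + 1)
      have h₂ := qChoose_mul (a + 1) b
      have e : ∀ N, qPochhammer (N + 1) = qPochhammer N * (1 - X ^ (N + 1)) :=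
        fun N => Finset.prod_range_succ _ _
      have s₁ : a + (b + 1) = a + b + 1 := by omega
      have s₂ : a + 1 + b = a + b + 1 := by omega
      have s₃ : a + 1 + (b + 1) = a + b + 1 + 1 := by omega
      rw [s₁] at h₁
      rw [s₂] at h₂
      rw [s₃, qChoose, e (a + b + 1), e a, e b]
      rw [e b] at h₁
      rw [e a] at h₂
      linear_combination (1 - X ^ (a + 1)) * h₁ + X ^ (a + 1) * (1 - X ^ (b + 1)) * h₂

/-- For `0 ≤ M ≤ N` the Gaussian binomial is the quotient `(q)_N / ((q)_M (q)_{N-M})`. -/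
theorem gaussBinom_mul {N M : ℕ} (h : M ≤ N) :
    gaussBinom N M * (qPochhammer M * qPochhammer (N - M)) = qPochhammer N := by
  have h' := qChoose_mul M (N - M)
  rw [Nat.add_sub_of_le h] at h'
  simpa [gaussBinom, h] using h'

/-- The exponent `r((2k+1)r + 2k - 2i + 1)/2`. -/
def bosonicExponent (k i : ℕ) (r : ℤ) : ℤ :=
  r * ((2 * k + 1) * r + 2 * k - 2 * i + 1) / 2

/-- The division by `2` in the exponent is exact. -/
theorem two_mul_bosonicExponent (k i : ℕ) (r : ℤ) :
    2 * bosonicExponent k i r = r * ((2 * k + 1) * r + 2 * k - 2 * i + 1) := by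
  refine Int.mul_ediv_cancel' ?_
  have e : r * ((2 * k + 1) * r + 2 * k - 2 * i + 1)
      = 2 * (r * (k * r + k - i)) + r * (r + 1) := by ring
  rw [e]
  exact dvd_add (dvd_mul_right _ _) (Int.even_mul_succ_self r).two_dvd

/-- The exponent is a natural number, so `q` to this exponent is a polynomial. -/
theorem bosonicExponent_nonneg {k i : ℕ} (hi : 1 ≤ i) (hik : i ≤ k) (r : ℤ) :
    0 ≤ bosonicExponent k i r := by
  have h := two_mul_bosonicExponent k i r
  have hi' : (1 : ℤ) ≤ i := by exact_mod_cast hi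
  have hik' : (i : ℤ) ≤ k := by exact_mod_cast hik
  have : 0 ≤ r * ((2 * k + 1) * r + 2 * k - 2 * i + 1) := by
    rcases le_or_gt 0 r with hr | hr
    · exact mul_nonneg hr (by nlinarith)
    · exact mul_nonneg_of_nonpos_of_nonpos hr.le (by nlinarith)
  omega

/-- The summand with index `r ∈ ℤ` of the alternating sum. The integer division by `2`
is the floor. -/
noncomputable def bosonicTerm (k i n : ℕ) (r : ℤ) : ℤ[X] :=
  ((r.negOnePow : ℤˣ) : ℤ) • (X ^ (bosonicExponent k i r).toNat *
    gaussBinom n (((n : ℤ) - k + i - (2 * k + 1) * r) / 2))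

/-- The entry of `A^{(k)}` in row `i` and column `j` (both counted from `1`):
`j - i + 1` on and above the diagonal, `0` below it. -/
def alpha (i j : ℕ) : ℤ := if i ≤ j then (j : ℤ) - i + 1 else 0

/-- The part `n_j` of a tuple `(n_1, …, n_{k-1})`, for `1 ≤ j ≤ k - 1`; the value is `0` for
other `j`, in particular `n_k = 0`. -/
def part {k : ℕ} (m : Fin (k - 1) → ℕ) (j : ℕ) : ℕ :=
  if h : 1 ≤ j ∧ j ≤ k - 1 then m ⟨j - 1, by omega⟩ else 0

/-- The tuples `n_1 ≥ ⋯ ≥ n_{k-1} ≥ 0` with `2 (n_1 + ⋯ + n_{k-1}) ≤ n - k + i`. The bound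
`n_j ≤ n` that makes the set visibly finite is implied when `i ≤ k`. -/
def tuples (k i n : ℕ) : Finset (Fin (k - 1) → ℕ) :=
  {m ∈ Fintype.piFinset fun _ : Fin (k - 1) => Finset.range (n + 1) |
    (∀ a b : Fin (k - 1), a ≤ b → m b ≤ m a) ∧ 2 * ((∑ j, m j : ℕ) : ℤ) ≤ (n : ℤ) - k + i}

theorem mem_tuples {k i n : ℕ} (hik : i ≤ k) (m : Fin (k - 1) → ℕ) :
    m ∈ tuples k i n ↔ Antitone m ∧ 2 * ((∑ j, m j : ℕ) : ℤ) ≤ (n : ℤ) - k + i := by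
  simp only [tuples, Finset.mem_filter, Fintype.mem_piFinset, Finset.mem_range]
  constructor
  · rintro ⟨_, h₁, h₂⟩
    exact ⟨fun a b hab => h₁ a b hab, h₂⟩
  · rintro ⟨h₁, h₂⟩
    refine ⟨fun a => ?_, fun a b hab => h₁ hab, h₂⟩
    have : m a ≤ ∑ j, m j := Finset.single_le_sum (fun _ _ => Nat.zero_le _) (Finset.mem_univ a)
    omega

/-- The summand of the multisum at the tuple `(n_1, …, n_{k-1})`. -/
noncomputable def fermionicTerm (k i n : ℕ) (m : Fin (k - 1) → ℕ) : ℤ[X] :=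
  X ^ ((∑ j ∈ Finset.Icc 1 (k - 1), part m j ^ 2) + (∑ j ∈ Finset.Icc i (k - 1), part m j)) *
    ∏ j ∈ Finset.Icc 1 (k - 1),
      gaussBinom
        ((n : ℤ) - 2 * (∑ l ∈ Finset.Icc 1 (j - 1), (part m l : ℤ))
          - part m j - part m (j + 1) - alpha i j)
        ((part m j : ℤ) - part m (j + 1))

end FiniteGordon

namespace FiniteGordon

/-! Both sides are refined by the largest part $p=n_1$, and the refinements agree for each $p$
(`refinedFermionic_eq_refinedBosonic`). Below, $c$ is $k-i$ of the theorem and `i` is its $i-1$.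
Splitting off $n_1$ makes the multisum a recursion. The alternating side becomes a sum of terms $\pm
q^{\cdots}[x,p-r][y,p+r]$ with $x+y=n$; $q$-Vandermonde sums out $p$ and gives back the original sum
(`sum_refinedBosonic`).

The alternating side obeys the same recursion by a Burge transform: $x+y$ is independent of $r$, so
the binomial joining consecutive parts is common to all $r$, and $q$-Saalschütz sums over the
smaller part term by term, at the cost of $q^{r^2}$. This raises $i$. At $i=0$ it is $c$ that must
rise; the result is off by a power of $q$ and a lowered top index, which $q$-Pascal repairs because
the leftover sum is antisymmetric under $r\mapsto-1-r$ (`sum_sgn_floorIndex_shift`).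

For $c=i=0$ and $p\ge1$, two such cancellations express the sum for $n$ as $q^{2p}$ times that for
$n-2$, so it vanishes by descent to negative $n$. -/

/-! ### Summation formulas for Gaussian polynomials -/

theorem qChoose_zero_right (N : ℕ) : qChoose N 0 = 1 := by
  cases N <;> rfl

theorem qChoose_succ_succ (N M : ℕ) :
    qChoose (N + 1) (M + 1) = qChoose N M + X ^ (M + 1) * qChoose N (M + 1) := by
  rw [qChoose]

theorem qPochhammer_mul_ne_zero (a b : ℕ) : qPochhammer a * qPochhammer b ≠ 0 :=
  mul_ne_zero (qPochhammer_ne_zero a) (qPochhammer_ne_zero b)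

theorem qChoose_symm_add (a b : ℕ) : qChoose (a + b) a = qChoose (a + b) b := by
  refine mul_right_cancel₀ (qPochhammer_mul_ne_zero a b) ?_
  have h := qChoose_mul b a
  rw [add_comm b a] at h
  rw [qChoose_mul, mul_comm (qPochhammer a), h]

/-- Both sides are the $q$-trinomial coefficient $(q)_{a+b+c}/((q)_a(q)_b(q)_c)$. -/
theorem qChoose_mul_qChoose (a b c : ℕ) :
    qChoose (a + b + c) a * qChoose (b + c) b = qChoose (a + b + c) (a + b) * qChoose (a + b) a := by
  refine mul_right_cancel₀ (mul_ne_zero (qPochhammer_mul_ne_zero a b) (qPochhammer_ne_zero c)) ?_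
  refine mul_right_cancel₀ (qPochhammer_mul_ne_zero (b + c) (a + b)) ?_
  have h₁ := qChoose_mul a (b + c)
  have h₂ := qChoose_mul b c
  have h₃ := qChoose_mul (a + b) c
  have h₄ := qChoose_mul a b
  rw [← add_assoc] at h₁
  calc _ = (qChoose (a + b + c) a * (qPochhammer a * qPochhammer (b + c))) *
        (qChoose (b + c) b * (qPochhammer b * qPochhammer c)) * qPochhammer (a + b) := by ring
    _ = (qChoose (a + b + c) (a + b) * (qPochhammer (a + b) * qPochhammer c)) *
        (qChoose (a + b) a * (qPochhammer a * qPochhammer b)) * qPochhammer (b + c) := by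
      rw [h₁, h₂, h₃, h₄]; ring
    _ = _ := by ring

/-- The `q`-Chu–Vandermonde summation. -/
theorem qChoose_add (m n K : ℕ) :
    qChoose (m + n) K = ∑ j ∈ Finset.range (K + 1),
      X ^ ((m - j) * (K - j)) * (qChoose m j * qChoose n (K - j)) := by
  induction m generalizing K with
  | zero =>
    rw [Finset.sum_range_succ', Finset.sum_eq_zero]
    · simp [qChoose_zero_right]
    · intro j _
      rw [qChoose_eq_zero 0 (j + 1) (by omega)]
      simp
  | succ m ih =>
    cases K with
    | zero => simp [qChoose_zero_right]
    | succ K =>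
      rw [show m + 1 + n = m + n + 1 by ring, qChoose_succ_succ, ih K, ih (K + 1),
        Finset.sum_range_succ' _ (K + 1), Finset.sum_range_succ' _ (K + 1), mul_add,
        Finset.mul_sum, ← add_assoc, ← Finset.sum_add_distrib]
      congr 1
      · refine Finset.sum_congr rfl fun j hj => ?_
        have hj' : j ≤ K := by simpa [Nat.lt_succ_iff] using hj
        rw [show m + 1 - (j + 1) = m - j by omega, show K + 1 - (j + 1) = K - j by omega,
          qChoose_succ_succ]
        rcases Nat.lt_or_ge m (j + 1) with h | h
        · rw [qChoose_eq_zero m (j + 1) h]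
          ring
        · obtain ⟨u, rfl⟩ := Nat.exists_eq_add_of_le h
          obtain ⟨v, rfl⟩ := Nat.exists_eq_add_of_le hj'
          rw [show j + 1 + u - (j + 1) = u by omega, show j + 1 + u - j = u + 1 by omega,
            show j + v - j = v by omega]
          ring
      · simp only [qChoose_zero_right, Nat.sub_zero]
        ring

theorem qChoose_add_symm (y P s : ℕ) :
    qChoose (y + P) (P + s) = ∑ i ∈ Finset.range (P + 1),
      X ^ (i * (i + s)) * (qChoose P i * qChoose y (i + s)) := by
  rw [add_comm y P, qChoose_add, show P + s + 1 = P + 1 + s by ring, Finset.sum_range_add,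
    add_eq_left.2, ← Finset.sum_range_reflect]
  · refine Finset.sum_congr rfl fun i hi => ?_
    have hi' : i ≤ P := by simpa [Nat.lt_succ_iff] using hi
    obtain ⟨u, rfl⟩ := Nat.exists_eq_add_of_le hi'
    rw [show i + u + 1 - 1 - i = u by omega, show i + u - u = i by omega,
      show i + u + s - u = i + s by omega, qChoose_symm_add]
  · refine Finset.sum_eq_zero fun i _ => ?_
    rw [qChoose_eq_zero P (P + 1 + i) (by omega)]
    simp

theorem qChoose_add_rev (u N K : ℕ) (h : K ≤ N) :
    qChoose (u + N) K = ∑ t ∈ Finset.range (K + 1),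
      X ^ (t * (N - K + t)) * (qChoose u t * qChoose N (K - t)) := by
  rw [add_comm u N, qChoose_add, ← Finset.sum_range_reflect]
  refine Finset.sum_congr rfl fun t ht => ?_
  have ht' : t ≤ K := by simpa [Nat.lt_succ_iff] using ht
  rw [show K + 1 - 1 - t = K - t by omega, show K - (K - t) = t by omega,
    show N - (K - t) = N - K + t by omega]
  ring

/-- A `q`-Saalschütz summation for Gaussian polynomials. -/
theorem sum_qChoose_mul_qChoose_mul_qChoose (x y s P : ℕ) :
    ∑ j ∈ Finset.range (P + 1), X ^ (j * (j + s)) *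
      (qChoose x j * qChoose y (j + s) * qChoose (x + y + P - j) (P - j)) =
    qChoose (x + P + s) P * qChoose (y + P) (P + s) := by
  have expand : ∀ j ∈ Finset.range (P + 1), X ^ (j * (j + s)) *
      (qChoose x j * qChoose y (j + s) * qChoose (x + y + P - j) (P - j)) =
      ∑ t ∈ Finset.range (P - j + 1), X ^ (j * (j + s)) * X ^ (t * (x + s + j + t)) *
        (qChoose x j * qChoose y (j + t + s) * qChoose (j + t + s) t *
          qChoose (x + P + s) (P - (j + t))) := by
    intro j hj
    have hj' : j ≤ P := by simpa [Nat.lt_succ_iff] using hj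
    rcases Nat.lt_or_ge y (j + s) with h | h
    · rw [qChoose_eq_zero y _ h, Finset.sum_eq_zero]
      · simp
      · intro t _
        rw [qChoose_eq_zero y (j + t + s) (by omega)]
        simp
    · obtain ⟨u, rfl⟩ := Nat.exists_eq_add_of_le h
      -- Vandermonde for this split: $u=y-j-s$ combines with $[y,j+s]$, and $x+P+s$ does not depend
      -- on $j$.
      rw [show x + (j + s + u) + P - j = u + (x + P + s) by omega,
        qChoose_add_rev u (x + P + s) (P - j) (by omega), Finset.mul_sum, Finset.mul_sum]
      refine Finset.sum_congr rfl fun t ht => ?_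
      rw [show x + P + s - (P - j) + t = x + s + j + t by omega,
        show P - j - t = P - (j + t) by omega]
      have key : qChoose (j + s + u) (j + s) * qChoose u t =
          qChoose (j + s + u) (j + t + s) * qChoose (j + t + s) t := by
        rcases Nat.lt_or_ge u t with h' | h'
        · rw [qChoose_eq_zero u t h', qChoose_eq_zero _ (j + t + s) (by omega)]
          simp
        · obtain ⟨v, rfl⟩ := Nat.exists_eq_add_of_le h'
          have e := qChoose_mul_qChoose (j + s) t v
          rw [qChoose_symm_add (j + s) t] at e
          rw [show j + t + s = j + s + t by ring, ← add_assoc (j + s) t v]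
          exact e
      linear_combination (X ^ (j * (j + s)) * X ^ (t * (x + s + j + t)) * qChoose x j *
        qChoose (x + P + s) (P - (j + t))) * key
  -- Collected by $i=j+t$, the sum over $j$ is Vandermonde for $x+(s+i)$; the right side, expanded
  -- by Vandermonde, is then matched term by term in $i$.
  rw [Finset.sum_congr rfl expand, qChoose_add_symm y P s, Finset.mul_sum]
  have regroup : ∀ F : ℕ → ℕ → ℤ[X],
      ∑ j ∈ Finset.range (P + 1), ∑ t ∈ Finset.range (P - j + 1), F j t =
      ∑ i ∈ Finset.range (P + 1), ∑ j ∈ Finset.range (i + 1), F j (i - j) := by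
    intro F
    rw [Finset.sum_sigma', Finset.sum_sigma']
    refine Finset.sum_bij' (fun a _ => ⟨a.1 + a.2, a.1⟩) (fun a _ => ⟨a.2, a.1 - a.2⟩)
      ?_ ?_ ?_ ?_ ?_
    · rintro ⟨a, b⟩ h
      simp only [Finset.mem_sigma, Finset.mem_range] at h ⊢
      omega
    · rintro ⟨a, b⟩ h
      simp only [Finset.mem_sigma, Finset.mem_range] at h ⊢
      omega
    · rintro ⟨a, b⟩ h
      simp
    · rintro ⟨a, b⟩ h
      simp only [Finset.mem_sigma, Finset.mem_range] at h
      simp only [Sigma.mk.injEq, heq_eq_eq, and_true]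
      omega
    · rintro ⟨a, b⟩ h
      simp
  rw [regroup]
  refine Finset.sum_congr rfl fun i hi => ?_
  have hi' : i ≤ P := by simpa [Nat.lt_succ_iff] using hi
  have inner : ∑ j ∈ Finset.range (i + 1), X ^ (j * (j + s)) * X ^ ((i - j) * (x + s + j + (i - j)))
      * (qChoose x j * qChoose y (j + (i - j) + s) * qChoose (j + (i - j) + s) (i - j) *
          qChoose (x + P + s) (P - (j + (i - j)))) =
      X ^ (i * (i + s)) * qChoose y (i + s) * qChoose (x + P + s) (P - i) *
        qChoose (x + (s + i)) i := by
    rw [qChoose_add x (s + i) i, Finset.mul_sum]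
    refine Finset.sum_congr rfl fun j hj => ?_
    have hj' : j ≤ i := by simpa [Nat.lt_succ_iff] using hj
    rw [show j + (i - j) = i by omega, add_comm i s]
    rcases Nat.lt_or_ge x j with h | h
    · rw [qChoose_eq_zero x j h]
      simp
    · obtain ⟨v, rfl⟩ := Nat.exists_eq_add_of_le h
      obtain ⟨w, rfl⟩ := Nat.exists_eq_add_of_le hj'
      rw [show j + w - j = w by omega, show j + v - j = v by omega]
      ring
  rw [inner]
  obtain ⟨w, rfl⟩ := Nat.exists_eq_add_of_le hi'
  have e := qChoose_mul_qChoose w i (x + s)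
  rw [show i + w - i = w by omega, show x + (i + w) + s = w + i + (x + s) by ring,
    show x + (s + i) = i + (x + s) by ring, add_comm i w]
  rw [qChoose_symm_add w i] at e
  linear_combination X ^ (i * (i + s)) * qChoose y (i + s) * e

/-! ### Gaussian binomials with integer arguments -/

theorem gaussBinom_natCast (N M : ℕ) : gaussBinom N M = qChoose N M := by
  unfold gaussBinom
  split_ifs with h
  · simp
  · rw [qChoose_eq_zero N M (by omega)]

theorem gaussBinom_of_neg {N M : ℤ} (h : M < 0) : gaussBinom N M = 0 :=
  if_neg (by omega)

theorem gaussBinom_of_lt {N M : ℤ} (h : N < M) : gaussBinom N M = 0 :=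
  if_neg (by omega)

theorem gaussBinom_of_top_neg {N M : ℤ} (h : N < 0) : gaussBinom N M = 0 :=
  if_neg (by omega)

theorem gaussBinom_symm {N a b : ℤ} (h : a + b = N) : gaussBinom N a = gaussBinom N b := by
  subst h
  rcases lt_or_ge a 0 with ha | ha
  · rw [gaussBinom_of_neg ha, gaussBinom_of_lt (by omega)]
  rcases lt_or_ge b 0 with hb | hb
  · rw [gaussBinom_of_neg hb, gaussBinom_of_lt (by omega)]
  lift a to ℕ using ha
  lift b to ℕ using hb
  rw [← Nat.cast_add, gaussBinom_natCast, gaussBinom_natCast, qChoose_symm_add]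

/-- At $N=M=0$, the only exception, the left side is 1 and the right side 0. -/
theorem gaussBinom_pascal {N M : ℤ} (h : N ≠ 0 ∨ M ≠ 0) :
    gaussBinom N M = X ^ M.toNat * gaussBinom (N - 1) M + gaussBinom (N - 1) (M - 1) := by
  rcases lt_or_ge M 0 with hM | hM
  · rw [gaussBinom_of_neg hM, gaussBinom_of_neg hM, gaussBinom_of_neg (by omega)]
    simp
  rcases lt_or_ge N 0 with hN | hN
  · rw [gaussBinom_of_top_neg hN, gaussBinom_of_top_neg (by omega),
      gaussBinom_of_top_neg (by omega)]
    simp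
  lift M to ℕ using hM
  lift N to ℕ using hN
  rcases N with _ | N
  · rw [gaussBinom_of_lt (by omega), gaussBinom_of_lt (by omega), gaussBinom_of_lt (by omega)]
    simp
  · have e : ((N + 1 : ℕ) : ℤ) - 1 = N := by omega
    rcases M with _ | M
    · rw [e, gaussBinom_natCast, gaussBinom_natCast, gaussBinom_of_neg (by omega)]
      simp [qChoose_zero_right]
    · have e' : ((M + 1 : ℕ) : ℤ) - 1 = M := by omega
      rw [e, e', gaussBinom_natCast, gaussBinom_natCast, gaussBinom_natCast, qChoose_succ_succ,
        Int.toNat_natCast, add_comm]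

theorem sum_range_shift {a p : ℕ} (h : a ≤ p) {f : ℕ → ℤ[X]} (hf : ∀ m < a, f m = 0) :
    ∑ m ∈ Finset.range (p + 1), f m = ∑ j ∈ Finset.range (p - a + 1), f (a + j) := by
  rw [show p + 1 = a + (p - a + 1) by omega, Finset.sum_range_add, add_eq_right]
  exact Finset.sum_eq_zero fun m hm => hf m (Finset.mem_range.1 hm)

theorem sum_gaussBinom_saalschutz_nat (x y a p : ℕ) :
    ∑ m ∈ Finset.range (p + 1), X ^ m ^ 2 * (gaussBinom (x + y + p - m) (p - m) *
      (gaussBinom x (m - a) * gaussBinom y (m + a))) =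
    X ^ a ^ 2 * (gaussBinom (x + p + a) (p - a) * gaussBinom (y + p - a) (p + a)) := by
  rcases Nat.lt_or_ge p a with h | h
  · rw [gaussBinom_of_neg (N := x + p + a) (by omega), Finset.sum_eq_zero]
    · simp
    · intro m hm
      rw [Finset.mem_range] at hm
      rw [gaussBinom_of_neg (N := x) (by omega)]
      simp
  · rw [sum_range_shift h]
    · obtain ⟨P, rfl⟩ := Nat.exists_eq_add_of_le h
      have e := sum_qChoose_mul_qChoose_mul_qChoose x y (2 * a) P
      rw [show (x : ℤ) + (a + P : ℕ) + a = (x + P + 2 * a : ℕ) by push_cast; ring,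
        show ((a + P : ℕ) : ℤ) - a = P by omega,
        show (y : ℤ) + (a + P : ℕ) - a = (y + P : ℕ) by push_cast; ring,
        show ((a + P : ℕ) : ℤ) + a = (P + 2 * a : ℕ) by push_cast; ring,
        gaussBinom_natCast, gaussBinom_natCast, ← e, Finset.mul_sum,
        show a + P - a = P by omega]
      refine Finset.sum_congr rfl fun j hj => ?_
      rw [Finset.mem_range] at hj
      rw [show (x : ℤ) + y + (a + P : ℕ) - (a + j : ℕ) = (x + y + P - j : ℕ) by omega,
        show ((a + P : ℕ) : ℤ) - (a + j : ℕ) = (P - j : ℕ) by omega,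
        show ((a + j : ℕ) : ℤ) - a = j by omega,
        show ((a + j : ℕ) : ℤ) + a = (j + 2 * a : ℕ) by omega,
        gaussBinom_natCast, gaussBinom_natCast, gaussBinom_natCast]
      ring
    · intro m hm
      rw [gaussBinom_of_neg (N := x) (by omega)]
      simp

/-- The `q`-Saalschütz summation in the form of a Burge transform. -/
theorem sum_gaussBinom_saalschutz {x y r : ℤ} {p : ℕ}
    (h : -2 * r ≤ x → 2 * r ≤ y → 0 ≤ x ∧ 0 ≤ y) :
    ∑ m ∈ Finset.range (p + 1), X ^ m ^ 2 * (gaussBinom (x + y + p - m) (p - m) *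
      (gaussBinom x (m - r) * gaussBinom y (m + r))) =
    X ^ r.natAbs ^ 2 * (gaussBinom (x + p + r) (p - r) * gaussBinom (y + p - r) (p + r)) := by
  by_cases hxy : 0 ≤ x ∧ 0 ≤ y
  · obtain ⟨hx, hy⟩ := hxy
    lift x to ℕ using hx
    lift y to ℕ using hy
    obtain ⟨a, rfl | rfl⟩ := r.eq_nat_or_neg
    · simpa using sum_gaussBinom_saalschutz_nat x y a p
    · have e := sum_gaussBinom_saalschutz_nat y x a p
      simp only [Int.natAbs_neg, Int.natAbs_natCast, sub_neg_eq_add, ← sub_eq_add_neg]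
      rw [mul_comm (gaussBinom (x + p - a) _), ← e]
      refine Finset.sum_congr rfl fun m _ => ?_
      rw [mul_comm (gaussBinom x _), add_comm (x : ℤ)]
  -- A negative top index kills the left side; `h` is what makes the right side vanish too.
  · have hr : gaussBinom (x + p + r) (p - r) * gaussBinom (y + p - r) (p + r) = 0 := by
      by_cases h₁ : -2 * r ≤ x
      · rw [gaussBinom_of_lt (N := y + p - r) (by by_contra h₂; exact hxy (h h₁ (by omega))),
          mul_zero]
      · rw [gaussBinom_of_lt (by omega), zero_mul]
    rw [hr, mul_zero]
    refine Finset.sum_eq_zero fun m _ => ?_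
    by_cases hx : 0 ≤ x
    · rw [gaussBinom_of_top_neg (N := y) (by omega)]
      simp
    · rw [gaussBinom_of_top_neg (N := x) (by omega)]
      simp

theorem sum_gaussBinom_vandermonde_nat (x y a n : ℕ) (hn : x + y ≤ n) :
    ∑ p ∈ Finset.range (n + 1), X ^ p ^ 2 *
      (gaussBinom x (p - a) * gaussBinom y (p + a)) =
    X ^ a ^ 2 * gaussBinom (x + y) (x + 2 * a) := by
  rcases Nat.lt_or_ge n a with h | h
  · rw [gaussBinom_of_lt (N := x + y) (by omega), Finset.sum_eq_zero]
    · simp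
    · intro m hm
      rw [gaussBinom_of_lt (N := y) (by omega)]
      simp
  · rw [sum_range_shift h]
    · rw [show (x : ℤ) + y = (y + x : ℕ) by push_cast; ring,
        show (x : ℤ) + 2 * a = (x + 2 * a : ℕ) by push_cast; ring, gaussBinom_natCast,
        qChoose_add_symm, Finset.mul_sum]
      have term : ∀ j : ℕ, X ^ (a + j) ^ 2 * (gaussBinom x ((a + j : ℕ) - a) *
          gaussBinom y ((a + j : ℕ) + a)) =
          X ^ a ^ 2 * (X ^ (j * (j + 2 * a)) * (qChoose x j * qChoose y (j + 2 * a))) := by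
        intro j
        rw [show ((a + j : ℕ) : ℤ) - a = j by omega,
          show ((a + j : ℕ) : ℤ) + a = (j + 2 * a : ℕ) by omega,
          gaussBinom_natCast, gaussBinom_natCast]
        ring
      rw [Finset.sum_congr rfl fun j _ => term j]
      have vanish : ∀ j, x < j ∨ y < j + 2 * a →
          X ^ a ^ 2 * (X ^ (j * (j + 2 * a)) * (qChoose x j * qChoose y (j + 2 * a))) =
            (0 : ℤ[X]) := by
        rintro j (hj | hj) <;> rw [qChoose_eq_zero _ _ hj] <;> simp
      -- Both ranges shrink to a common one: $j>x$ kills the first factor, and $a+j>n\ge x+y$ the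
      -- second.
      rw [← Finset.sum_subset (Finset.range_mono (by omega : min x (n - a) + 1 ≤ n - a + 1)),
        ← Finset.sum_subset (Finset.range_mono (by omega : min x (n - a) + 1 ≤ x + 1))]
      · intro j _ hj
        rw [Finset.mem_range] at hj
        exact vanish j (by omega)
      · intro j _ hj
        rw [Finset.mem_range] at hj
        exact vanish j (by omega)
    · intro m hm
      rw [gaussBinom_of_neg (N := x) (by omega)]
      simp

theorem sum_gaussBinom_vandermonde {x y r : ℤ} {n : ℕ} (hn : x + y = n)
    (h : 0 ≤ y - 2 * r → y - 2 * r ≤ n → 0 ≤ x ∧ 0 ≤ y) :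
    ∑ p ∈ Finset.range (n + 1), X ^ p ^ 2 * (gaussBinom x (p - r) * gaussBinom y (p + r)) =
    X ^ r.natAbs ^ 2 * gaussBinom n (y - 2 * r) := by
  by_cases hxy : 0 ≤ x ∧ 0 ≤ y
  · obtain ⟨hx, hy⟩ := hxy
    lift x to ℕ using hx
    lift y to ℕ using hy
    obtain ⟨a, rfl | rfl⟩ := r.eq_nat_or_neg
    · have e := sum_gaussBinom_vandermonde_nat x y a n (by omega)
      rw [hn, gaussBinom_symm (b := y - 2 * a) (by omega)] at e
      simpa using e
    · have e := sum_gaussBinom_vandermonde_nat y x a n (by omega)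
      rw [add_comm (y : ℤ) x, hn] at e
      simp only [Int.natAbs_neg, Int.natAbs_natCast, sub_neg_eq_add, ← sub_eq_add_neg, mul_neg]
      rw [← e]
      refine Finset.sum_congr rfl fun m _ => ?_
      rw [mul_comm (gaussBinom x _)]
  · have hr : gaussBinom n (y - 2 * r) = 0 := if_neg fun h' => hxy (h h'.1 h'.2)
    rw [hr, mul_zero]
    refine Finset.sum_eq_zero fun m _ => ?_
    by_cases hx : 0 ≤ x
    · rw [gaussBinom_of_top_neg (N := y) (by omega)]
      simp
    · rw [gaussBinom_of_top_neg (N := x) (by omega)]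
      simp

/-! ### Refined polynomials and the Burge transform -/

/-- The triangular number `r (r + 1) / 2` of an integer. -/
def tri (r : ℤ) : ℕ := (r * (r + 1) / 2).toNat

theorem two_mul_tri (r : ℤ) : 2 * (tri r : ℤ) = r * (r + 1) := by
  have h₁ : 0 ≤ r * (r + 1) := by
    rcases le_or_gt 0 r with h | h
    · positivity
    · exact mul_nonneg_of_nonpos_of_nonpos (by omega) (by omega)
  have h₂ := (Int.even_mul_succ_self r).two_dvd
  unfold tri
  omega

theorem tri_neg_one_sub (r : ℤ) : tri (-1 - r) = tri r := by
  have h₁ := two_mul_tri r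
  have h₂ := two_mul_tri (-1 - r)
  have e : (-1 - r) * (-1 - r + 1) = r * (r + 1) := by ring
  omega

theorem tri_sub_one (r : ℤ) : (tri (r - 1) : ℤ) = tri r - r := by
  have h₁ := two_mul_tri r
  have h₂ := two_mul_tri (r - 1)
  have e : (r - 1) * (r - 1 + 1) = r * (r + 1) - 2 * r := by ring
  omega

theorem two_mul_tri_eq (r : ℤ) : 2 * (tri r : ℤ) = (r.natAbs ^ 2 : ℕ) + r := by
  rw [two_mul_tri]
  push_cast
  rw [sq_abs]
  ring

/-- The sign `(-1)^r` as a polynomial. -/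
noncomputable def sgn (r : ℤ) : ℤ[X] := (((r.negOnePow : ℤˣ) : ℤ) : ℤ[X])

theorem sgn_odd_sub {s : ℤ} (hs : Odd s) (r : ℤ) : sgn (s - r) = -sgn r := by
  unfold sgn
  rw [Int.negOnePow_sub, Int.negOnePow_odd s hs]
  simp

/-- The lower index `⌊(n - c - (2 (c + i) - 1) r) / 2⌋`. -/
def floorIndex (c i : ℕ) (n r : ℤ) : ℤ := (n - c - (2 * (c + i) - 1) * r) / 2

/-- The alternating sum that refines the bosonic polynomial by the largest part `p`. -/
noncomputable def refinedBosonic (c i : ℕ) (n : ℤ) (p : ℕ) : ℤ[X] :=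
  X ^ p ^ 2 * ∑ r ∈ Finset.Icc (-p : ℤ) p,
    sgn r * X ^ ((2 * c + 1) * tri r + i * r.natAbs ^ 2) *
      (gaussBinom (n - floorIndex c i n r) (p - r) * gaussBinom (floorIndex c i n r) (p + r))

/-- The multisum with prescribed largest part `p`, by recursion on the number of parts. -/
noncomputable def refinedFermionic : ℕ → ℕ → ℤ → ℕ → ℤ[X]
  | 0, _, n, p => if p = 0 ∧ 0 ≤ n then 1 else 0
  | d + 1, 0, n, p => X ^ (p ^ 2 + p) * ∑ m ∈ Finset.range (p + 1),
      gaussBinom (n - p - m - 1) (p - m) * refinedFermionic d 0 (n - 2 * p - 1) m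
  | d + 1, i + 1, n, p => X ^ p ^ 2 * ∑ m ∈ Finset.range (p + 1),
      gaussBinom (n - p - m) (p - m) * refinedFermionic d i (n - 2 * p) m

/-- The side condition of the Saalschütz and Vandermonde sums for $x=n-y$ and $y$ the floor:
wherever the right side can be nonzero, the top indices on the left are nonnegative. -/
theorem floorIndex_spec (c i : ℕ) (n r : ℤ) (h₁ : -2 * r ≤ n - floorIndex c i n r)
    (h₂ : 2 * r ≤ floorIndex c i n r) : 0 ≤ n - floorIndex c i n r ∧ 0 ≤ floorIndex c i n r := by
  have e : (2 * ((c : ℤ) + i) - 1) * r = 2 * (c * r) + 2 * (i * r) - r := by ring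
  unfold floorIndex at h₁ h₂ ⊢
  rw [e] at h₁ h₂ ⊢
  rcases lt_trichotomy r 0 with h | rfl | h
  -- As $r\le-1$, the term $-2cr$ outweighs the $-c$ in the numerator.
  · have h₃ : (c : ℤ) * r ≤ c * (-1) := mul_le_mul_of_nonneg_left (by omega) (by omega)
    have h₄ : (i : ℤ) * r ≤ 0 := mul_nonpos_of_nonneg_of_nonpos (by omega) h.le
    omega
  · omega
  · have h₃ : 0 ≤ (c : ℤ) * r := by positivity
    have h₄ : 0 ≤ (i : ℤ) * r := by positivity
    omega

theorem sum_gaussBinom_mul_refinedBosonic (c i : ℕ) (n : ℤ) (p : ℕ) :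
    ∑ m ∈ Finset.range (p + 1), gaussBinom (n + p - m) (p - m) * refinedBosonic c i n m =
    ∑ r ∈ Finset.Icc (-p : ℤ) p, sgn r * X ^ ((2 * c + 1) * tri r + (i + 1) * r.natAbs ^ 2) *
      (gaussBinom (n - floorIndex c i n r + p + r) (p - r) *
        gaussBinom (floorIndex c i n r + p - r) (p + r)) := by
  have extend : ∀ m ∈ Finset.range (p + 1),
      gaussBinom (n + p - m) (p - m) * refinedBosonic c i n m =
      ∑ r ∈ Finset.Icc (-p : ℤ) p, sgn r * X ^ ((2 * c + 1) * tri r + i * r.natAbs ^ 2) *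
        (X ^ m ^ 2 * (gaussBinom (n - floorIndex c i n r + floorIndex c i n r + p - m) (p - m) *
        (gaussBinom (n - floorIndex c i n r) (m - r) *
          gaussBinom (floorIndex c i n r) (m + r)))) := by
    intro m hm
    rw [Finset.mem_range] at hm
    rw [refinedBosonic, Finset.mul_sum, Finset.mul_sum]
    rw [← Finset.sum_subset (Finset.Icc_subset_Icc (by omega : (-p : ℤ) ≤ -m)
      (by omega : (m : ℤ) ≤ p))]
    · refine Finset.sum_congr rfl fun r _ => ?_
      rw [sub_add_cancel]
      ring
    · intro r _ hr
      rw [Finset.mem_Icc] at hr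
      by_cases h : r ≤ m
      · rw [gaussBinom_of_neg (M := m + r) (by omega)]
        simp
      · rw [gaussBinom_of_neg (M := m - r) (by omega)]
        simp
  rw [Finset.sum_congr rfl extend, Finset.sum_comm]
  refine Finset.sum_congr rfl fun r _ => ?_
  rw [← Finset.mul_sum, sum_gaussBinom_saalschutz (floorIndex_spec c i n r)]
  ring

/-! ### Cancellation by reflection of $r$, and the base case -/

theorem sum_Icc_eq_zero_of_antisymm {a b s : ℤ} (hs : a + b = s) {f : ℤ → ℤ[X]}
    (hf : ∀ r, f (s - r) = -f r) : ∑ r ∈ Finset.Icc a b, f r = 0 := by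
  have h : ∑ r ∈ Finset.Icc a b, f r = ∑ r ∈ Finset.Icc a b, f (s - r) := by
    refine Finset.sum_bij' (fun r _ => s - r) (fun r _ => s - r) ?_ ?_ ?_ ?_ ?_
    all_goals intro r hr
    · rw [Finset.mem_Icc] at hr ⊢
      omega
    · rw [Finset.mem_Icc] at hr ⊢
      omega
    · simp
    · simp
    · simp
  rw [Finset.sum_congr rfl fun r _ => hf r, Finset.sum_neg_distrib] at h
  exact self_eq_neg.1 h

theorem floorIndex_zero (c : ℕ) (n r : ℤ) :
    floorIndex c 0 n r = (n - c - 2 * (c * r) + r) / 2 := by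
  unfold floorIndex
  congr 1
  push_cast
  ring

theorem floorIndex_reflect (c : ℕ) (n r : ℤ) :
    floorIndex c 0 n (-1 - r) = n - floorIndex c 0 n r - 1 := by
  have e : (c : ℤ) * (-1 - r) = -c - c * r := by ring
  rw [floorIndex_zero, floorIndex_zero, e]
  omega

/-- Pascal on the first binomial leaves a second sum, where $r\mapsto-1-r$ swaps the two binomials
(`floorIndex_reflect`), fixes $r(r+1)/2$ and flips the sign. -/
theorem sum_sgn_floorIndex_shift (c : ℕ) (n : ℤ) (p : ℕ) (hcp : 1 ≤ c ∨ 1 ≤ p) :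
    ∑ r ∈ Finset.Icc (-p : ℤ) p, sgn r * X ^ ((2 * c + 1) * tri r) *
      (gaussBinom (n - floorIndex c 0 n r) (p - r) * gaussBinom (floorIndex c 0 n r) (p + r)) =
    ∑ r ∈ Finset.Icc (-p : ℤ) p, sgn r * X ^ ((2 * c + 1) * tri r + (p - r).toNat) *
      (gaussBinom (n - floorIndex c 0 n r - 1) (p - r) *
        gaussBinom (floorIndex c 0 n r) (p + r)) := by
  have cancel : ∑ r ∈ Finset.Icc (-p : ℤ) p, sgn r * X ^ ((2 * c + 1) * tri r) *
      (gaussBinom (n - floorIndex c 0 n r - 1) (p - r - 1) *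
        gaussBinom (floorIndex c 0 n r) (p + r)) = 0 := by
    -- The term $r=p$ has lower index $-1$; without it the range is symmetric about $-1/2$.
    rw [← Finset.sum_subset (Finset.Icc_subset_Icc le_rfl (by omega : (p : ℤ) - 1 ≤ p))]
    · refine sum_Icc_eq_zero_of_antisymm (s := -1) (by ring) fun r => ?_
      rw [sgn_odd_sub (by decide), tri_neg_one_sub, floorIndex_reflect,
        show n - (n - floorIndex c 0 n r - 1) - 1 = floorIndex c 0 n r by ring,
        show (p : ℤ) - (-1 - r) - 1 = p + r by ring, show (p : ℤ) + (-1 - r) = p - r - 1 by ring]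
      ring
    · intro r hr hr'
      rw [Finset.mem_Icc] at hr hr'
      rw [gaussBinom_of_neg (M := p - r - 1) (by omega)]
      simp
  rw [← add_zero (∑ r ∈ Finset.Icc (-p : ℤ) p, sgn r * X ^ (_ + _) * _), ← cancel,
    ← Finset.sum_add_distrib]
  refine Finset.sum_congr rfl fun r hr => ?_
  rw [Finset.mem_Icc] at hr
  by_cases h : n - floorIndex c 0 n r ≠ 0 ∨ (p : ℤ) - r ≠ 0
  · rw [gaussBinom_pascal h]
    ring
  -- In the case $[0,0]$ barred from Pascal, $r=p$ and the floor equals $n$, so $n\le p-c-2cp<2p$ by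
  -- `hcp`.
  · have hy : gaussBinom (floorIndex c 0 n r) (p + r) = 0 := by
      refine gaussBinom_of_lt ?_
      have h₁ : 0 ≤ (c : ℤ) * r := mul_nonneg (by omega) (by omega)
      rw [floorIndex_zero] at h ⊢
      omega
    rw [hy]
    simp

/-- After the shift above, Pascal on the second binomial lowers its top index too; the leftover
cancels under $r\mapsto1-r$. -/
theorem sum_sgn_floorIndex_zero {p : ℕ} (hp : 1 ≤ p) (n : ℤ) :
    ∑ r ∈ Finset.Icc (-p : ℤ) p, sgn r * X ^ tri r *
      (gaussBinom (n - (n + r) / 2) (p - r) * gaussBinom ((n + r) / 2) (p + r)) =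
    X ^ (2 * p) * ∑ r ∈ Finset.Icc (-p : ℤ) p, sgn r * X ^ tri r *
      (gaussBinom (n - 2 - (n - 2 + r) / 2) (p - r) * gaussBinom ((n - 2 + r) / 2) (p + r)) := by
  have shift := sum_sgn_floorIndex_shift 0 n p (Or.inr hp)
  have hfl : ∀ r, floorIndex 0 0 n r = (n + r) / 2 := fun r => by
    rw [floorIndex_zero]
    simp
  simp only [hfl, mul_zero, zero_add, one_mul] at shift
  have cancel : ∑ r ∈ Finset.Icc (-p : ℤ) p, sgn r * X ^ (p + tri (r - 1)) *
      (gaussBinom (n - (n + r) / 2 - 1) (p - r) *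
        gaussBinom ((n + r) / 2 - 1) (p + r - 1)) = 0 := by
    rw [← Finset.sum_subset (Finset.Icc_subset_Icc (by omega : -(p : ℤ) ≤ 1 - p) le_rfl)]
    · refine sum_Icc_eq_zero_of_antisymm (s := 1) (by ring) fun r => ?_
      rw [sgn_odd_sub (by decide), show 1 - r - 1 = -1 - (r - 1) by ring, tri_neg_one_sub,
        show n - (n + (1 - r)) / 2 - 1 = (n + r) / 2 - 1 by omega,
        show (n + (1 - r)) / 2 - 1 = n - (n + r) / 2 - 1 by omega,
        show (p : ℤ) - (1 - r) = p + r - 1 by ring, show (p : ℤ) + (1 - r) - 1 = p - r by ring]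
      ring
    · intro r hr hr'
      rw [Finset.mem_Icc] at hr hr'
      rw [gaussBinom_of_neg (M := p + r - 1) (by omega)]
      simp
  rw [shift, ← add_zero (X ^ (2 * p) * _), ← cancel, Finset.mul_sum, ← Finset.sum_add_distrib]
  refine Finset.sum_congr rfl fun r hr => ?_
  rw [Finset.mem_Icc] at hr
  have ht := tri_sub_one r
  rw [show tri r + (p - r).toNat = p + tri (r - 1) by omega,
    show n - 2 - (n - 2 + r) / 2 = n - (n + r) / 2 - 1 by omega,
    show (n - 2 + r) / 2 = (n + r) / 2 - 1 by omega]
  by_cases h : (n + r) / 2 ≠ 0 ∨ (p : ℤ) + r ≠ 0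
  · have hexp : (X : ℤ[X]) ^ (p + tri (r - 1)) * X ^ ((p : ℤ) + r).toNat =
        X ^ (2 * p) * X ^ tri r := by
      rw [← pow_add, ← pow_add]
      congr 1
      omega
    rw [gaussBinom_pascal h]
    linear_combination sgn r * gaussBinom (n - (n + r) / 2 - 1) (p - r) *
      gaussBinom ((n + r) / 2 - 1) (p + r) * hexp
  · rw [gaussBinom_of_lt (N := n - (n + r) / 2 - 1) (by omega)]
    simp

theorem sum_sgn_gaussBinom_eq_zero {p : ℕ} (hp : 1 ≤ p) (n : ℤ) :
    ∑ r ∈ Finset.Icc (-p : ℤ) p, sgn r * X ^ tri r *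
      (gaussBinom (n - (n + r) / 2) (p - r) * gaussBinom ((n + r) / 2) (p + r)) = 0 := by
  by_cases hn : n < 0
  · refine Finset.sum_eq_zero fun r _ => ?_
    by_cases h : (n + r) / 2 < 0
    · rw [gaussBinom_of_top_neg h]
      simp
    · rw [gaussBinom_of_top_neg (N := n - (n + r) / 2) (by omega)]
      simp
  · rw [sum_sgn_floorIndex_zero hp, sum_sgn_gaussBinom_eq_zero hp (n - 2), mul_zero]
-- The offset makes the measure drop at $n=0$ as well.
termination_by (n + 2).toNat
decreasing_by omega

theorem refinedFermionic_zero (i : ℕ) (n : ℤ) (p : ℕ) :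
    refinedFermionic 0 i n p = refinedBosonic 0 0 n p := by
  have hfl : ∀ r, floorIndex 0 0 n r = (n + r) / 2 := fun r => by
    rw [floorIndex_zero]
    simp
  rw [refinedFermionic, refinedBosonic]
  simp only [hfl, mul_zero, zero_add, one_mul, zero_mul, add_zero]
  rcases Nat.eq_zero_or_pos p with rfl | hp
  · have h : ∀ N : ℤ, gaussBinom N 0 = if 0 ≤ N then 1 else 0 := fun N => by
      simp [gaussBinom, qChoose_zero_right]
    simp only [CharP.cast_eq_zero, neg_zero, Finset.Icc_self, Finset.sum_singleton, add_zero,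
      sub_zero, h, sgn, tri, Int.negOnePow_zero]
    by_cases hn : 0 ≤ n
    · have h₁ : 0 ≤ n / 2 := by omega
      have h₂ : n / 2 ≤ n := by omega
      simp [hn, h₁, h₂]
    · have h₁ : ¬0 ≤ n / 2 := by omega
      simp [hn, h₁]
  · rw [sum_sgn_gaussBinom_eq_zero hp, if_neg (by omega), mul_zero]

/-! ### Equality of the refinements -/

theorem floorIndex_succ (c i : ℕ) (n r : ℤ) (p : ℕ) :
    floorIndex c (i + 1) n r = floorIndex c i (n - 2 * p) r + p - r := by
  have e : n - c - (2 * (c + (i + 1 : ℕ)) - 1) * r =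
      n - 2 * p - c - (2 * (c + i) - 1) * r + (p - r) * 2 := by
    push_cast
    ring
  unfold floorIndex
  rw [e, Int.add_mul_ediv_right _ _ (by norm_num)]
  ring

theorem floorIndex_succ_zero (c : ℕ) (n r : ℤ) (p : ℕ) :
    floorIndex (c + 1) 0 n r = floorIndex c 0 (n - 2 * p - 1) r + p - r := by
  have e : n - (c + 1 : ℕ) - (2 * ((c + 1 : ℕ) + (0 : ℕ)) - 1) * r =
      n - 2 * p - 1 - c - (2 * (c + (0 : ℕ)) - 1) * r + (p - r) * 2 := by
    push_cast
    ring
  unfold floorIndex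
  rw [e, Int.add_mul_ediv_right _ _ (by norm_num)]
  ring

/-- The refinement of the polynomial identity by the largest part. -/
theorem refinedFermionic_eq_refinedBosonic (c i : ℕ) (n : ℤ) (p : ℕ) :
    refinedFermionic (c + i) i n p = refinedBosonic c i n p := by
  induction i generalizing n p with
  | succ i ih =>
    rw [← add_assoc, refinedFermionic, refinedBosonic]
    congr 1
    have h := sum_gaussBinom_mul_refinedBosonic c i (n - 2 * p) p
    rw [show n - 2 * (p : ℤ) + p = n - p by ring] at h
    rw [Finset.sum_congr rfl fun m _ => by rw [ih], h]
    refine Finset.sum_congr rfl fun r _ => ?_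
    rw [floorIndex_succ c i n r p, show n - (floorIndex c i (n - 2 * p) r + p - r) =
      n - 2 * p - floorIndex c i (n - 2 * p) r + p + r by ring]
  | zero =>
    induction c generalizing n p with
    | zero => exact refinedFermionic_zero 0 n p
    | succ c ih =>
      rw [add_zero] at ih
      rw [add_zero, refinedFermionic, refinedBosonic]
      have h := sum_gaussBinom_mul_refinedBosonic c 0 (n - 2 * p - 1) p
      have hm : ∀ m : ℕ, n - 2 * (p : ℤ) - 1 + p - m = n - p - m - 1 := fun m => by ring
      simp only [hm] at h
      rw [Finset.sum_congr rfl fun m _ => by rw [ih], h]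
      simp only [zero_mul, add_zero]
      -- With $T=r(r+1)/2$ and $2T=r^2+r$, the exponent $(2c+3)T+p-r$ becomes $p+(2c+1)T+r^2$: the
      -- linear weight $q^p$ times the Saalschütz output.
      rw [sum_sgn_floorIndex_shift (c + 1) n p (Or.inl (by omega)), pow_add, mul_assoc,
        Finset.mul_sum]
      congr 1
      refine Finset.sum_congr rfl fun r hr => ?_
      rw [Finset.mem_Icc] at hr
      rw [floorIndex_succ_zero c n r p, show n - (floorIndex c 0 (n - 2 * p - 1) r + p - r) - 1 =
        n - 2 * p - 1 - floorIndex c 0 (n - 2 * p - 1) r + p + r by ring]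
      have ht := two_mul_tri_eq r
      rw [show (2 * (c + 1) + 1) * tri r + (p - r).toNat =
        p + ((2 * c + 1) * tri r + (0 + 1) * r.natAbs ^ 2) by
          rw [show (2 * (c + 1) + 1) * tri r = (2 * c + 1) * tri r + 2 * tri r by ring]
          omega]
      ring

/-! ### Summing the alternating side over the largest part -/

/-- The separate $r^2$ and the shift $-2r$ are what Vandermonde produces on summing over $p$. -/
theorem bosonicTerm_eq (c i n : ℕ) (r : ℤ) :
    bosonicTerm (c + i + 1) (i + 1) n r =
      sgn r * X ^ ((2 * c + 1) * tri r + i * r.natAbs ^ 2 + r.natAbs ^ 2) *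
        gaussBinom n (floorIndex c i n r - 2 * r) := by
  have hexp : (bosonicExponent (c + i + 1) (i + 1) r).toNat =
      (2 * c + 1) * tri r + i * r.natAbs ^ 2 + r.natAbs ^ 2 := by
    have h₁ := two_mul_bosonicExponent (c + i + 1) (i + 1) r
    have h₂ : 2 * (((2 * c + 1) * tri r + i * r.natAbs ^ 2 + r.natAbs ^ 2 : ℕ) : ℤ) =
        r * ((2 * (c + i + 1 : ℕ) + 1) * r + 2 * (c + i + 1 : ℕ) - 2 * (i + 1 : ℕ) + 1) := by
      push_cast
      rw [sq_abs]
      linear_combination (2 * (c : ℤ) + 1) * two_mul_tri r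
    omega
  have hidx : ((n : ℤ) - (c + i + 1 : ℕ) + (i + 1 : ℕ) - (2 * (c + i + 1 : ℕ) + 1) * r) / 2 =
      floorIndex c i n r - 2 * r := by
    have e : (n : ℤ) - (c + i + 1 : ℕ) + (i + 1 : ℕ) - (2 * (c + i + 1 : ℕ) + 1) * r =
        n - c - (2 * (c + i) - 1) * r + (-2 * r) * 2 := by
      push_cast
      ring
    unfold floorIndex
    rw [e, Int.add_mul_ediv_right _ _ (by norm_num)]
    ring
  rw [bosonicTerm, hexp, hidx, zsmul_eq_mul, sgn, mul_assoc]

theorem support_bosonicTerm_subset (c i n : ℕ) :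
    Function.support (bosonicTerm (c + i + 1) (i + 1) n) ⊆ Finset.Icc (-n : ℤ) n := by
  intro r hr
  rw [Finset.coe_Icc, Set.mem_Icc]
  by_contra h
  refine hr ?_
  rw [bosonicTerm_eq, gaussBinom, if_neg, mul_zero]
  rintro ⟨h₁, h₂⟩
  have e : (2 * ((c : ℤ) + i) - 1) * r = 2 * (c * r) + 2 * (i * r) - r := by ring
  unfold floorIndex at h₁ h₂
  rw [e] at h₁ h₂
  rcases le_or_gt 0 r with h₀ | h₀
  · have h₃ : 0 ≤ (c : ℤ) * r := by positivity
    have h₄ : 0 ≤ (i : ℤ) * r := by positivity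
    omega
  · have h₃ : (c : ℤ) * r ≤ c * (-1) := mul_le_mul_of_nonneg_left (by omega) (by omega)
    have h₄ : (i : ℤ) * r ≤ 0 := mul_nonpos_of_nonneg_of_nonpos (by omega) h₀.le
    omega

theorem sum_refinedBosonic (c i n : ℕ) :
    ∑ p ∈ Finset.range (n + 1), refinedBosonic c i n p =
      ∑ r ∈ Finset.Icc (-n : ℤ) n, bosonicTerm (c + i + 1) (i + 1) n r := by
  have extend : ∀ p ∈ Finset.range (n + 1), refinedBosonic c i n p =
      ∑ r ∈ Finset.Icc (-n : ℤ) n, sgn r * X ^ ((2 * c + 1) * tri r + i * r.natAbs ^ 2) *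
        (X ^ p ^ 2 * (gaussBinom (n - floorIndex c i n r) (p - r) *
          gaussBinom (floorIndex c i n r) (p + r))) := by
    intro p hp
    rw [Finset.mem_range] at hp
    rw [refinedBosonic, Finset.mul_sum]
    rw [← Finset.sum_subset (Finset.Icc_subset_Icc (by omega : (-n : ℤ) ≤ -p)
      (by omega : (p : ℤ) ≤ n))]
    · exact Finset.sum_congr rfl fun r _ => by ring
    · intro r _ hr
      rw [Finset.mem_Icc] at hr
      by_cases h : r ≤ p
      · rw [gaussBinom_of_neg (M := p + r) (by omega)]
        simp
      · rw [gaussBinom_of_neg (M := p - r) (by omega)]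
        simp
  rw [Finset.sum_congr rfl extend, Finset.sum_comm]
  refine Finset.sum_congr rfl fun r _ => ?_
  rw [← Finset.mul_sum, sum_gaussBinom_vandermonde (by ring) fun h₁ h₂ =>
    floorIndex_spec c i n r (by omega) (by omega), bosonicTerm_eq]
  ring

/-! ### The multisum as a recursion -/

/-- The summand of the multisum for the sequence `f 0, f 1, …, f (d - 1)` of parts, by recursion
on the number `d` of parts. -/
noncomputable def weight : ℕ → ℕ → ℤ → (ℕ → ℕ) → ℤ[X]
  | 0, _, n, _ => if 0 ≤ n then 1 else 0
  | d + 1, 0, n, f => X ^ (f 0 ^ 2 + f 0) * (gaussBinom (n - f 0 - f 1 - 1) (f 0 - f 1) *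
      weight d 0 (n - 2 * f 0 - 1) fun j => f (j + 1))
  | d + 1, i + 1, n, f => X ^ f 0 ^ 2 * (gaussBinom (n - f 0 - f 1) (f 0 - f 1) *
      weight d i (n - 2 * f 0) fun j => f (j + 1))

/-- A tuple extended by zeros to a sequence. -/
def extendZero {d : ℕ} (m : Fin d → ℕ) (j : ℕ) : ℕ := if h : j < d then m ⟨j, h⟩ else 0

theorem extendZero_cons_zero {d : ℕ} (p : ℕ) (m : Fin d → ℕ) :
    extendZero (Fin.cons p m : Fin (d + 1) → ℕ) 0 = p := by
  simp [extendZero]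

theorem extendZero_cons_succ {d : ℕ} (p : ℕ) (m : Fin d → ℕ) (j : ℕ) :
    extendZero (Fin.cons p m : Fin (d + 1) → ℕ) (j + 1) = extendZero m j := by
  unfold extendZero
  by_cases h : j < d
  · rw [dif_pos h, dif_pos (by omega)]
    exact Fin.cons_succ (α := fun _ => ℕ) p m ⟨j, h⟩
  · rw [dif_neg h, dif_neg (by omega)]

theorem sum_piFinset_succ (d B : ℕ) (F : (Fin (d + 1) → ℕ) → ℤ[X]) :
    ∑ m ∈ Fintype.piFinset fun _ : Fin (d + 1) => Finset.range B, F m =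
      ∑ p ∈ Finset.range B, ∑ m ∈ Fintype.piFinset fun _ : Fin d => Finset.range B,
        F (Fin.cons p m) := by
  rw [← Finset.sum_product']
  refine Finset.sum_bij' (fun m _ => (m 0, Fin.tail m)) (fun a _ => Fin.cons a.1 a.2)
    ?_ ?_ ?_ ?_ ?_
  · intro m hm
    rw [Fintype.mem_piFinset] at hm
    rw [Finset.mem_product, Fintype.mem_piFinset]
    exact ⟨hm 0, fun j => hm j.succ⟩
  · rintro ⟨p, m⟩ h
    rw [Finset.mem_product, Fintype.mem_piFinset] at h
    rw [Fintype.mem_piFinset]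
    intro j
    refine Fin.cases ?_ (fun j => ?_) j
    · simpa using h.1
    · simpa using h.2 j
  · intro m _
    exact Fin.cons_self_tail m
  · rintro ⟨p, m⟩ _
    simp
  · intro m _
    rw [Fin.cons_self_tail]

theorem sum_range_gaussBinom_sub {B p : ℕ} (hp : p < B) (N : ℕ → ℤ) (G : ℕ → ℤ[X]) :
    ∑ m ∈ Finset.range B, gaussBinom (N m) (p - m) * G m =
      ∑ m ∈ Finset.range (p + 1), gaussBinom (N m) (p - m) * G m := by
  refine (Finset.sum_subset (Finset.range_mono hp) fun m _ hm => ?_).symm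
  rw [Finset.mem_range] at hm
  rw [gaussBinom_of_neg (by omega), zero_mul]

/-- An arbitrary factor `g` of the first part lets the induction absorb the binomial joining the
first two parts. -/
theorem sum_weight (d i B : ℕ) (hB : 0 < B) (n : ℤ) (g : ℕ → ℤ[X]) :
    ∑ m ∈ Fintype.piFinset fun _ : Fin d => Finset.range B,
      g (extendZero m 0) * weight d i n (extendZero m) =
    ∑ p ∈ Finset.range B, g p * refinedFermionic d i n p := by
  induction d generalizing i n g with
  | zero =>
    rw [Finset.sum_eq_single (M := ℤ[X]) (s := Finset.range B) 0]
    · simp [weight, refinedFermionic, extendZero]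
    · intro p _ hp
      simp [refinedFermionic, hp]
    · intro h
      exact absurd (Finset.mem_range.2 hB) h
  | succ d ih =>
    rw [sum_piFinset_succ]
    refine Finset.sum_congr rfl fun p hp => ?_
    rw [Finset.mem_range] at hp
    have h₁ : ∀ m : Fin d → ℕ,
        extendZero (Fin.cons p m : Fin (d + 1) → ℕ) 1 = extendZero m 0 :=
      fun m => extendZero_cons_succ p m 0
    cases i with
    | zero =>
      simp only [weight, refinedFermionic, h₁, extendZero_cons_zero, extendZero_cons_succ]
      rw [← Finset.mul_sum, ← Finset.mul_sum]
      congr 2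
      rw [← sum_range_gaussBinom_sub hp]
      exact ih 0 (n - 2 * p - 1) fun m => gaussBinom (n - p - m - 1) (p - m)
    | succ i =>
      simp only [weight, refinedFermionic, h₁, extendZero_cons_zero, extendZero_cons_succ]
      rw [← Finset.mul_sum, ← Finset.mul_sum]
      congr 2
      rw [← sum_range_gaussBinom_sub hp]
      exact ih i (n - 2 * p) fun m => gaussBinom (n - p - m) (p - m)

/-- The truncated difference `d - i` counts the steps after `i` has reached 0. Each lowers $n$ by an
extra 1, which accumulates to `alpha` in the top indices and to $k-i$ in the bound on the tuples. -/
theorem weight_eq (d i : ℕ) (n : ℤ) (f : ℕ → ℕ) :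
    weight d i n f =
      if 0 ≤ n - 2 * ∑ j ∈ Finset.range d, (f j : ℤ) - (d - i : ℕ) then
        X ^ ((∑ j ∈ Finset.range d, f j ^ 2) + ∑ j ∈ Finset.range d, if i ≤ j then f j else 0) *
          ∏ j ∈ Finset.range d, gaussBinom
            (n - 2 * ∑ l ∈ Finset.range j, (f l : ℤ) - f j - f (j + 1) - alpha (i + 1) (j + 1))
            (f j - f (j + 1))
      else 0 := by
  induction d generalizing i n f with
  | zero => simp [weight]
  | succ d ih =>
    rw [Finset.sum_range_succ', Finset.sum_range_succ', Finset.sum_range_succ' _ d,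
      Finset.prod_range_succ']
    have hα : ∀ j, alpha (0 + 1) (j + 1 + 1) = alpha (0 + 1) (j + 1) + 1 := fun j => by
      unfold alpha
      rw [if_pos (by omega), if_pos (by omega)]
      push_cast
      ring
    have hα' : ∀ i j, alpha (i + 1 + 1) (j + 1 + 1) = alpha (i + 1) (j + 1) := fun i j => by
      unfold alpha
      split_ifs <;> omega
    cases i with
    | zero =>
      rw [weight, ih]
      have hc : (0 ≤ n - 2 * (f 0 : ℤ) - 1 - 2 * ∑ j ∈ Finset.range d, (f (j + 1) : ℤ) -
          (d - 0 : ℕ)) ↔ 0 ≤ n - 2 * (∑ j ∈ Finset.range d, (f (j + 1) : ℤ) + f 0) -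
          (d + 1 - 0 : ℕ) := by omega
      by_cases h : 0 ≤ n - 2 * (∑ j ∈ Finset.range d, (f (j + 1) : ℤ) + f 0) - (d + 1 - 0 : ℕ)
      · rw [if_pos h, if_pos (hc.2 h)]
        have hprod : ∀ j ∈ Finset.range d, gaussBinom (n - 2 * ∑ l ∈ Finset.range (j + 1), (f l : ℤ)
            - f (j + 1) - f (j + 1 + 1) - alpha (0 + 1) (j + 1 + 1)) (f (j + 1) - f (j + 1 + 1)) =
            gaussBinom (n - 2 * (f 0 : ℤ) - 1 - 2 * ∑ l ∈ Finset.range j, (f (l + 1) : ℤ)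
            - f (j + 1) - f (j + 1 + 1) - alpha (0 + 1) (j + 1)) (f (j + 1) - f (j + 1 + 1)) := by
          intro j _
          rw [Finset.sum_range_succ', hα]
          congr 1
          ring
        rw [Finset.prod_congr rfl hprod]
        simp [alpha]
        ring
      · rw [if_neg h, if_neg (mt hc.1 h)]
        simp
    | succ i =>
      rw [weight, ih]
      have hc : (0 ≤ n - 2 * (f 0 : ℤ) - 2 * ∑ j ∈ Finset.range d, (f (j + 1) : ℤ) -
          (d - i : ℕ)) ↔ 0 ≤ n - 2 * (∑ j ∈ Finset.range d, (f (j + 1) : ℤ) + f 0) -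
          (d + 1 - (i + 1) : ℕ) := by omega
      by_cases h : 0 ≤ n - 2 * (∑ j ∈ Finset.range d, (f (j + 1) : ℤ) + f 0) -
          (d + 1 - (i + 1) : ℕ)
      · rw [if_pos h, if_pos (hc.2 h)]
        have hprod : ∀ j ∈ Finset.range d, gaussBinom (n - 2 * ∑ l ∈ Finset.range (j + 1), (f l : ℤ)
            - f (j + 1) - f (j + 1 + 1) - alpha (i + 1 + 1) (j + 1 + 1))
            (f (j + 1) - f (j + 1 + 1)) =
            gaussBinom (n - 2 * (f 0 : ℤ) - 2 * ∑ l ∈ Finset.range j, (f (l + 1) : ℤ)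
            - f (j + 1) - f (j + 1 + 1) - alpha (i + 1) (j + 1)) (f (j + 1) - f (j + 1 + 1)) := by
          intro j _
          rw [Finset.sum_range_succ', hα']
          congr 1
          ring
        rw [Finset.prod_congr rfl hprod]
        simp [alpha]
        ring
      · rw [if_neg h, if_neg (mt hc.1 h)]
        simp

theorem part_succ {d : ℕ} (m : Fin (d + 1 - 1) → ℕ) (j : ℕ) :
    part m (j + 1) = extendZero m j := by
  unfold part extendZero
  by_cases h : j < d
  · rw [dif_pos (by omega), dif_pos (by omega)]
    rfl
  · rw [dif_neg (by omega), dif_neg (by omega)]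

theorem sum_Icc_one (d : ℕ) {M : Type*} [AddCommMonoid M] (F : ℕ → M) :
    ∑ j ∈ Finset.Icc 1 d, F j = ∑ j ∈ Finset.range d, F (j + 1) := by
  rw [Finset.range_eq_Ico, Finset.sum_Ico_add' F 0 d 1]
  rfl

theorem prod_Icc_one (d : ℕ) {M : Type*} [CommMonoid M] (F : ℕ → M) :
    ∏ j ∈ Finset.Icc 1 d, F j = ∏ j ∈ Finset.range d, F (j + 1) := by
  rw [Finset.range_eq_Ico, Finset.prod_Ico_add' F 0 d 1]
  rfl

theorem sum_Icc_succ_eq (i d : ℕ) (F : ℕ → ℕ) :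
    ∑ j ∈ Finset.Icc (i + 1) d, F j = ∑ j ∈ Finset.range d, if i ≤ j then F (j + 1) else 0 := by
  rw [← Finset.sum_filter]
  refine Finset.sum_nbij' (fun j => j - 1) (fun j => j + 1) ?_ ?_ ?_ ?_ ?_
  all_goals intro j hj
  all_goals simp only [Finset.mem_filter, Finset.mem_range, Finset.mem_Icc] at hj ⊢
  · omega
  · omega
  · omega
  · omega
  · rw [show j - 1 + 1 = j by omega]

theorem fermionicTerm_eq (d i n : ℕ) (m : Fin (d + 1 - 1) → ℕ) :
    fermionicTerm (d + 1) (i + 1) n m =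
      X ^ ((∑ j ∈ Finset.range d, extendZero m j ^ 2) +
          ∑ j ∈ Finset.range d, if i ≤ j then extendZero m j else 0) *
        ∏ j ∈ Finset.range d, gaussBinom
          (n - 2 * ∑ l ∈ Finset.range j, (extendZero m l : ℤ) - extendZero m j -
            extendZero m (j + 1) - alpha (i + 1) (j + 1))
          (extendZero m j - extendZero m (j + 1)) := by
  simp only [fermionicTerm, Nat.add_sub_cancel, sum_Icc_one, prod_Icc_one, sum_Icc_succ_eq,
    part_succ]

theorem sum_extendZero {d : ℕ} (m : Fin d → ℕ) :
    ∑ j ∈ Finset.range d, (extendZero m j : ℤ) = ((∑ j, m j : ℕ) : ℤ) := by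
  rw [Finset.sum_range]
  push_cast
  refine Finset.sum_congr rfl fun j _ => ?_
  rw [extendZero, dif_pos j.2]

theorem sum_fermionicTerm (c i n : ℕ) :
    ∑ m ∈ tuples (c + i + 1) (i + 1) n, fermionicTerm (c + i + 1) (i + 1) n m =
      ∑ p ∈ Finset.range (n + 1), refinedFermionic (c + i) i n p := by
  have h := sum_weight (c + i) i (n + 1) n.succ_pos n fun _ => 1
  simp only [one_mul] at h
  have bound : ∀ m : Fin (c + i) → ℕ,
      (0 ≤ (n : ℤ) - 2 * ∑ j ∈ Finset.range (c + i), (extendZero m j : ℤ) - (c + i - i : ℕ)) ↔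
        2 * ((∑ j, m j : ℕ) : ℤ) ≤ (n : ℤ) - (c + i + 1 : ℕ) + (i + 1 : ℕ) := by
    intro m
    rw [sum_extendZero]
    omega
  rw [← h, tuples]
  refine (Finset.sum_congr rfl fun m hm => ?_).trans
    (Finset.sum_subset (Finset.filter_subset _ _) fun m hm hm' => ?_)
  · rw [Finset.mem_filter] at hm
    rw [fermionicTerm_eq, weight_eq, if_pos ((bound m).2 hm.2.2)]
  · rw [weight_eq]
    split_ifs with hb
    -- A tuple that is not decreasing has a factor with negative lower index, so only admissible
    -- tuples contribute.
    · by_contra hne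
      refine hm' (Finset.mem_filter.2 ⟨hm, ?_, (bound m).1 hb⟩)
      have anti : Antitone (extendZero m) := by
        refine antitone_nat_of_succ_le fun j => ?_
        rcases Nat.lt_or_ge j (c + i) with hj | hj
        · by_contra hlt
          refine right_ne_zero_of_mul hne (Finset.prod_eq_zero (Finset.mem_range.2 hj) ?_)
          exact gaussBinom_of_neg (by omega)
        · rw [extendZero, dif_neg (by omega)]
          exact Nat.zero_le _
      intro a b hab
      have := anti (show (a : ℕ) ≤ b from hab)
      rwa [extendZero, extendZero, dif_pos a.2, dif_pos b.2] at this
    · rfl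

end FiniteGordon

theorem theorem1 (n k i : ℕ) (hi : 1 ≤ i) (hik : i ≤ k) :
    (Function.support (FiniteGordon.bosonicTerm k i n)).Finite ∧
      ∑ᶠ r : ℤ, FiniteGordon.bosonicTerm k i n r =
        ∑ m ∈ FiniteGordon.tuples k i n, FiniteGordon.fermionicTerm k i n m := by
  obtain ⟨i, rfl⟩ := Nat.exists_eq_add_of_le' hi
  obtain ⟨c, rfl⟩ := Nat.exists_eq_add_of_le' hik
  rw [← add_assoc]
  have hs := FiniteGordon.support_bosonicTerm_subset c i n
  refine ⟨(Finset.finite_toSet _).subset hs, ?_⟩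
  rw [finsum_eq_sum_of_support_subset _ hs, ← FiniteGordon.sum_refinedBosonic,
    FiniteGordon.sum_fermionicTerm]
  exact Finset.sum_congr rfl fun p _ =>
    (FiniteGordon.refinedFermionic_eq_refinedBosonic c i n p).symm
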